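/- Let $G=(V,E)$ be a finite directed acyclic multigraph (network) whose edges are called channels, with a single source node $s$, and let $\mathcal F$ be a finite field. The source emits $w$ symbols of $\mathcal F$ per unit time, i.e. $w$ imaginary incoming channels of $s$ carry the standard basis vectors of $\mathcal F^w$ as global encoding kernels, and each channel $e$ has the global encoding kernel $f_e=\sum_{d\in \mathrm{In}(\mathrm{tail}(e))}k_{d,e}f_d\in\mathcal F^w$, where the local encoding coefficients $k_{d,e}$ (one for each adjacent pair of channels $(d,e)$) are independent random variables, uniformly distributed on $\mathcal F$. Let $t\neq s$ be a sink node such that $w\le C_t$, where $C_t$ is the minimum cut capacity between $s$ and $t$, let $F_t=(f_e : e\in \mathrm{In}(t))$, and let $P_{e_t}=\Pr(\mathrm{rank}(F_t)<w)$ be the failure probability of random linear network coding at $t$. Then there exist $w$ channel-disjoint paths from $s$ to $t$, and for every collection of $w$ channel-disjoint paths from $s$ to $t$, $$P_{e_t}\le 1-\left[\prod_{i=1}^{w}\left(1-\frac{1}{|\mathcal F|^i}\right)\right]^{r+1},$$ where $r$ is the number of internal nodes of the collection, i.e. of the distinct nodes other than $s$ and $t$ that lie on its paths. -/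

import Mathlib

/-- A single-source communication network: a directed multigraph with node set `V` and channel
set `E` (channel `e` leads from `tail e` to `head e`), without directed cycles, together with
its source node. -/
structure Network (V E : Type*) where
  tail : E → V
  head : E → V
  source : V
  acyclic : ∀ v : V, ¬ Relation.TransGen (fun a b => ∃ e, tail e = a ∧ head e = b) v v

namespace Network

variable {V E : Type*} (N : Network V E)

/-- Channel `e` leaves the node at which channel `d` arrives. -/
def Precedes (d e : E) : Prop := N.head d = N.tail e

theorem precedes_wf [Finite E] : WellFounded N.Precedes := by
  have key : ∀ d e, Relation.TransGen N.Precedes d e →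
      Relation.TransGen (fun a b => ∃ e, N.tail e = a ∧ N.head e = b) (N.tail d) (N.tail e) :=
    fun d e h => h.lift N.tail (fun a b hab => ⟨a, rfl, hab⟩)
  have : Std.Irrefl (Relation.TransGen N.Precedes) := ⟨fun e h => N.acyclic _ (key e e h)⟩
  have h := Finite.wellFounded_of_trans_of_irrefl (Relation.TransGen N.Precedes)
  exact Subrelation.wf (fun hab => Relation.TransGen.single hab) h

/-- The minimum cut capacity between the source and `t`: the least number of channels leading
from `A` to its complement, over all node sets `A` that contain the source and not `t`. -/
noncomputable def minCut (t : V) : ℕ :=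
  sInf {n | ∃ A : Set V, N.source ∈ A ∧ t ∉ A ∧ n = {e : E | N.tail e ∈ A ∧ N.head e ∉ A}.ncard}

/-- The node at which a channel arrives, where `Sum.inl j`, `j : Fin w`, are the `w` imaginary
incoming channels of the source (carrying the source symbols) and `Sum.inr e` are the channels of
the network. -/
def extHead (w : ℕ) : Fin w ⊕ E → V := Sum.elim (fun _ => N.source) N.head

/-- The incoming channels, imaginary ones included, of the node from which `e` leaves. -/
def Inputs (w : ℕ) (e : E) : Type _ := {d : Fin w ⊕ E // N.extHead w d = N.tail e}

/-- The adjacent pairs `(d, e)` of channels; each of them carries a local encoding coefficient. -/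
def AdjPair (w : ℕ) : Type _ := (e : E) × N.Inputs w e

noncomputable instance [Fintype E] (w : ℕ) (e : E) : Fintype (N.Inputs w e) :=
  Fintype.ofInjective (Subtype.val : {d : Fin w ⊕ E // N.extHead w d = N.tail e} → Fin w ⊕ E)
    Subtype.val_injective

noncomputable instance [Fintype E] (w : ℕ) : Fintype (N.AdjPair w) :=
  inferInstanceAs (Fintype ((e : E) × N.Inputs w e))

variable {F : Type*} [Field F]

/-- The global encoding kernels `f_e ∈ F ^ w` determined by the local encoding coefficients `k`:
the imaginary channels carry the standard basis, and
`f_e = ∑_{d ∈ In(tail e)} k_{d,e} f_d`. -/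
noncomputable def kernel [Fintype E] {w : ℕ} (k : N.AdjPair w → F) : E → (Fin w → F) :=
  N.precedes_wf.fix fun e f => ∑ d : N.Inputs w e, k ⟨e, d⟩ •
    (match d with
      | ⟨Sum.inl j, _⟩ => Pi.single j 1
      | ⟨Sum.inr d', h⟩ => f d' h)

/-- The recursion formula for the global encoding kernels. -/
theorem kernel_eq [Fintype E] {w : ℕ} (k : N.AdjPair w → F) (e : E) :
    N.kernel k e = ∑ d : N.Inputs w e, k ⟨e, d⟩ •
      Sum.elim (fun j => (Pi.single j 1 : Fin w → F)) (N.kernel k) d.1 := by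
  rw [kernel, WellFounded.fix_eq]
  refine Finset.sum_congr rfl fun d _ => ?_
  rcases d with ⟨d | d, h⟩ <;> rfl

/-- The decoding matrix `F_t`, whose columns are the `f_e`, `e ∈ In(t)` (for `t` not the
source). -/
noncomputable def decodingMatrix [Fintype E] {w : ℕ} (k : N.AdjPair w → F) (t : V) :
    Matrix (Fin w) {e : E // N.head e = t} F :=
  Matrix.of fun i e => N.kernel k e.1 i

open Classical in
/-- The failure probability at sink `t`, i.e. the probability that `rank F_t < w`, when the local
encoding coefficients are the random variables `K`. -/
noncomputable def sinkFailureProb [Fintype E] {w : ℕ} {Ω : Type*} [MeasurableSpace Ω]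
    (μ : MeasureTheory.Measure Ω) (K : N.AdjPair w → Ω → F) (t : V) : ℝ :=
  μ.real {ω | (N.decodingMatrix (fun p => K p ω) t).rank < w}

/-- The list of channels `p` is a (nonempty) directed path from the source to `t`. -/
def IsPathTo (t : V) (p : List E) : Prop :=
  p.IsChain N.Precedes ∧ p.head?.map N.tail = some N.source ∧ p.getLast?.map N.head = some t

/-- `P` is a collection of `w` channel-disjoint paths from the source to `t`. -/
def IsDisjointPaths {w : ℕ} (t : V) (P : Fin w → List E) : Prop :=
  (∀ j, N.IsPathTo t (P j)) ∧ ∀ i j, i ≠ j → List.Disjoint (P i) (P j)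

/-- The internal nodes of a collection of paths from the source to `t`: the nodes on the paths
other than the source and `t`. -/
def internalNodes {w : ℕ} (t : V) (P : Fin w → List E) : Set V :=
  {v | v ≠ N.source ∧ v ≠ t ∧ ∃ j, ∃ e ∈ P j, N.tail e = v ∨ N.head e = v}

end Network

/-! Existence of the paths is Menger's theorem, obtained from Hall's: source units and channels are
matched injectively to channels and exits, where an unused channel is matched to itself, so
following the matching traces out disjoint paths (`exists_disjointPaths`).

For the bound, fix the paths, number the nodes along the channels, and sweep a cut upwards,
separating the numbers below `n` from the rest. It starts at the imaginary channels, whose kernels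
are the standard basis. Passing a node `v` changes only the paths through `v`, say `m ≤ w` of them.
If the old kernels are a basis, then shifting the `m × m` local coefficients between the incoming
and outgoing path channels at `v` by `M` leaves everything upstream fixed, and the new kernels are a
basis as soon as `A + M` is invertible, with `A` independent of `M`
(`Matrix.exists_translate_det_ne_zero`). This holds for a proportion `invertibleRatio q m ≥
invertibleRatio q w` of the `M`.

Averaging over translates (`card_mul_le_of_translates`) turns this into a loss of at most one factor
`invertibleRatio q w` per node. Stopping the sweep at `t`, only the source and the internal nodes
can cost a factor: at most `r + 1` in all. -/

namespace Network

variable {V E : Type*} (N : Network V E)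

/-! ### Disjoint paths from Hall's theorem -/

theorem precedes_flip_wf [Finite E] : WellFounded (fun e d => N.Precedes d e) := by
  have : Std.Irrefl (fun e d => Relation.TransGen N.Precedes d e) :=
    ⟨fun e h => N.acyclic _ (h.lift N.tail fun a b hab => ⟨a, rfl, hab⟩)⟩
  have : IsTrans E (fun e d => Relation.TransGen N.Precedes d e) := ⟨fun _ _ _ h h' => h'.trans h⟩
  have h := Finite.wellFounded_of_trans_of_irrefl (fun e d => Relation.TransGen N.Precedes d e)
  exact Subrelation.wf (fun hab => Relation.TransGen.single hab) h

theorem minCut_le (t : V) (A : Set V) (hs : N.source ∈ A) (ht : t ∉ A) :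
    N.minCut t ≤ {e : E | N.tail e ∈ A ∧ N.head e ∉ A}.ncard :=
  Nat.sInf_le ⟨A, hs, ht, rfl⟩

/-- Admissible successors in a routing of `w` units from the source to `t`: a source unit goes to a
channel leaving the source; a channel is matched to itself (and then is unused), to a channel
following it, or, if it arrives at `t`, to one of the `w` exits. -/
def RoutingStep (w : ℕ) (t : V) : Fin w ⊕ E → E ⊕ Fin w → Prop
  | .inl _, .inl e => N.tail e = N.source
  | .inl _, .inr _ => False
  | .inr d, .inl e => d = e ∨ N.Precedes d e
  | .inr d, .inr _ => N.head d = t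

open Classical in
/-- Hall's theorem provides a matching of the routing steps when no cut is smaller than `w`. -/
theorem exists_injective_routing [Fintype E] (w : ℕ) (t : V) (ht : t ≠ N.source)
    (hw : w ≤ N.minCut t) :
    ∃ f : Fin w ⊕ E → E ⊕ Fin w, Function.Injective f ∧ ∀ x, N.RoutingStep w t x (f x) := by
  rw [← Fintype.all_card_le_filter_rel_iff_exists_injective]
  intro X
  rw [← Finset.card_toLeft_add_card_toRight (u := X)]
  set T : Finset (E ⊕ Fin w) := {b | ∃ a ∈ X, N.RoutingStep w t a b} with hT
  rw [← Finset.card_toLeft_add_card_toRight (u := T)]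
  have hYT : X.toRight ⊆ T.toLeft := by
    intro e he
    simp only [Finset.mem_toRight] at he
    simp only [Finset.mem_toLeft, hT, Finset.mem_filter, Finset.mem_univ, true_and]
    exact ⟨_, he, Or.inl rfl⟩
  have hJ : X.toLeft.card ≤ w := by simpa using Finset.card_le_univ X.toLeft
  -- Self-matching always gives `X.toRight ⊆ T.toLeft`; it remains to find a further neighbour for
  -- each source unit in `X`. A channel of `X` arriving at `t` supplies all `w` exits.
  by_cases hY : ∃ e ∈ X.toRight, N.head e = t
  · obtain ⟨e, he, het⟩ := hY
    have : T.toRight = Finset.univ := by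
      ext j
      simp only [Finset.mem_toRight, hT, Finset.mem_filter, Finset.mem_univ, true_and, iff_true]
      exact ⟨.inr e, by simpa using he, het⟩
    rw [this, Finset.card_univ, Fintype.card_fin, add_comm]
    exact Nat.add_le_add (Finset.card_le_card hYT) hJ
  · push Not at hY
    rcases X.toLeft.eq_empty_or_nonempty with hE | ⟨j, hj⟩
    · rw [hE, Finset.card_empty, zero_add]
      exact (Finset.card_le_card hYT).trans (Nat.le_add_right _ _)
    -- Take as cut the source and all heads of channels in `X`. A channel leaving it is a neighbour
    -- of `X`, and is not itself in `X` because its head lies outside. This gives `w` extra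
    -- neighbours.
    · have hcut := N.minCut_le t ({N.source} ∪ N.head '' (X.toRight : Set E)) (by simp) (by
        rintro (h | ⟨e, he, h⟩)
        · exact ht h
        · exact hY e he h)
      have hsub : {e : E | N.tail e ∈ ({N.source} ∪ N.head '' (X.toRight : Set E)) ∧
          N.head e ∉ ({N.source} ∪ N.head '' (X.toRight : Set E))} ⊆
          ((T.toLeft \ X.toRight : Finset E) : Set E) := by
        rintro e ⟨h1, h2⟩
        rw [Finset.mem_coe, Finset.mem_sdiff]
        refine ⟨?_, fun h => h2 (Or.inr ⟨e, h, rfl⟩)⟩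
        simp only [Finset.mem_toLeft, hT, Finset.mem_filter, Finset.mem_univ, true_and]
        rcases h1 with h1 | ⟨d, hd, h1⟩
        · exact ⟨.inl j, by simpa using hj, h1⟩
        · exact ⟨.inr d, by simpa using hd, Or.inr h1⟩
      have hle := Set.ncard_le_ncard hsub (Finset.finite_toSet _)
      rw [Set.ncard_coe_finset] at hle
      have := Finset.card_sdiff_add_card_eq_card hYT
      omega

/-- Following an injective routing from a channel that it uses leads to `t`. -/
theorem exists_routed_path [Finite E] {w : ℕ} {t : V} {f : Fin w ⊕ E → E ⊕ Fin w}
    (hf : Function.Injective f) (hstep : ∀ x, N.RoutingStep w t x (f x)) (e : E)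
    (he : f (.inr e) ≠ .inl e) :
    ∃ p : List E, p.IsChain (fun a b => f (.inr a) = .inl b ∧ N.Precedes a b) ∧
      p.head? = some e ∧ p.getLast?.map N.head = some t := by
  induction e using N.precedes_flip_wf.induction with
  | _ e ih =>
    have hs := hstep (.inr e)
    rcases hfe : f (.inr e) with e' | j
    · rw [hfe] at hs he
      have hee : e ≠ e' := fun h => he (by rw [h])
      have hp : N.Precedes e e' := hs.resolve_left hee
      -- `e'` is already the image of `e`, so by injectivity it is not matched to itself and the
      -- routing continues.
      obtain ⟨p, hp1, hp2, hp3⟩ := ih e' hp fun h => hee (by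
        simpa using hf (hfe.trans h.symm))
      refine ⟨e :: p, List.isChain_cons.2 ⟨?_, hp1⟩, rfl, ?_⟩
      · rw [hp2]
        rintro y hy
        obtain rfl : e' = y := by simpa using hy
        exact ⟨hfe, hp⟩
      · cases p with
        | nil => simp at hp2
        | cons a p => rwa [List.getLast?_cons_cons]
    · rw [hfe] at hs
      exact ⟨[e], List.isChain_singleton _, rfl, congrArg some hs⟩

/-- On a chain, every element other than the first has a predecessor. -/
theorem _root_.List.IsChain.eq_head_or_exists_rel {α : Type*} {R : α → α → Prop} {p : List α}
    (hp : p.IsChain R) {x : α} (hx : x ∈ p) : p.head? = some x ∨ ∃ y ∈ p, R y x := by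
  induction p with
  | nil => simp at hx
  | cons a p ih =>
    rcases List.mem_cons.1 hx with rfl | hx
    · exact Or.inl rfl
    · right
      rw [List.isChain_cons] at hp
      rcases ih hp.2 hx with h | ⟨y, hy, hyx⟩
      · exact ⟨a, by simp, hp.1 x h⟩
      · exact ⟨y, List.mem_cons_of_mem _ hy, hyx⟩

/-- The edge version of Menger's theorem for acyclic networks. -/
theorem exists_disjointPaths [Fintype E] (w : ℕ) (t : V) (ht : t ≠ N.source)
    (hw : w ≤ N.minCut t) : ∃ P : Fin w → List E, N.IsDisjointPaths t P := by
  obtain ⟨f, hf, hstep⟩ := N.exists_injective_routing w t ht hw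
  have hfirst : ∀ j : Fin w, ∃ e, f (.inl j) = .inl e ∧ N.tail e = N.source := by
    intro j
    have := hstep (.inl j)
    rcases h : f (.inl j) with e | i <;> rw [h] at this
    · exact ⟨e, rfl, this⟩
    · exact this.elim
  choose a ha has using hfirst
  choose P hP hhead hlast using fun j => N.exists_routed_path hf hstep (a j) fun h =>
    Sum.inl_ne_inr (hf ((ha j).trans h.symm))
  refine ⟨P, fun j => ⟨(hP j).imp fun _ _ h => h.2, by rw [hhead]; exact congrArg some (has j),
    hlast j⟩, fun i j hij x hi hj => hij ?_⟩
  -- Trace a shared channel upstream: its preimage under `f` is unique, so both paths have the same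
  -- predecessor there, or both start there from the same source unit. The mixed cases would equate
  -- a source unit with a channel.
  induction x using N.precedes_wf.induction with
  | _ x ih =>
    have hfst : ∀ j, (P j).head? = some x → f (.inl j) = .inl x := fun j h => by
      rw [ha, ← Option.some_inj.1 ((hhead j).symm.trans h)]
    rcases (hP i).eq_head_or_exists_rel hi with h | ⟨y, hy, h⟩ <;>
    rcases (hP j).eq_head_or_exists_rel hj with h' | ⟨z, hz, h'⟩
    · simpa using hf ((hfst i h).trans (hfst j h').symm)
    · simpa using hf ((hfst i h).trans h'.1.symm)
    · simpa using hf (h.1.trans (hfst j h').symm)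
    · obtain rfl : y = z := by simpa using hf (h.1.trans h'.1.symm)
      exact ih y h.2 hy hz

end Network

/-! ### Invertible matrices and averaging over translates -/

/-- The proportion of invertible matrices among the `m × m` matrices over a field with `q`
elements. -/
noncomputable def invertibleRatio (q m : ℕ) : ℝ := ∏ i ∈ Finset.Icc 1 m, (1 - 1 / (q : ℝ) ^ i)

theorem one_sub_one_div_pow_mem_Icc {q : ℕ} (hq : 1 ≤ q) (i : ℕ) :
    0 ≤ 1 - 1 / (q : ℝ) ^ i ∧ 1 - 1 / (q : ℝ) ^ i ≤ 1 := by
  have h1 : (1 : ℝ) ≤ (q : ℝ) ^ i := one_le_pow₀ (by exact_mod_cast hq)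
  have h2 : 1 / (q : ℝ) ^ i ≤ 1 := by rw [div_le_one (by linarith)]; exact h1
  have h3 : 0 ≤ 1 / (q : ℝ) ^ i := by positivity
  constructor <;> linarith

theorem invertibleRatio_nonneg {q : ℕ} (hq : 1 ≤ q) (m : ℕ) : 0 ≤ invertibleRatio q m :=
  Finset.prod_nonneg fun i _ => (one_sub_one_div_pow_mem_Icc hq i).1

theorem invertibleRatio_le_one {q : ℕ} (hq : 1 ≤ q) (m : ℕ) : invertibleRatio q m ≤ 1 :=
  Finset.prod_le_one (fun i _ => (one_sub_one_div_pow_mem_Icc hq i).1)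
    fun i _ => (one_sub_one_div_pow_mem_Icc hq i).2

theorem invertibleRatio_anti {q : ℕ} (hq : 1 ≤ q) {m n : ℕ} (hmn : m ≤ n) :
    invertibleRatio q n ≤ invertibleRatio q m := by
  rw [invertibleRatio, invertibleRatio,
    ← Finset.prod_sdiff (Finset.Icc_subset_Icc_right hmn : Finset.Icc 1 m ⊆ Finset.Icc 1 n)]
  exact mul_le_of_le_one_left (invertibleRatio_nonneg hq m)
    (Finset.prod_le_one (fun i _ => (one_sub_one_div_pow_mem_Icc hq i).1)
      fun i _ => (one_sub_one_div_pow_mem_Icc hq i).2)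

section MatrixCount

variable {F : Type*} [Field F] [Fintype F]

/-- Factor `q ^ m - q ^ i = (1 - 1 / q ^ (m - i)) * q ^ m` in the usual product for the order of the
group and reindex by `i ↦ m - i`. -/
theorem card_GL_eq_invertibleRatio_mul (m : ℕ) :
    (Nat.card (GL (Fin m) F) : ℝ) =
      invertibleRatio (Fintype.card F) m * (Fintype.card F : ℝ) ^ (m * m) := by
  have hq : (Fintype.card F : ℝ) ≠ 0 := by exact_mod_cast Fintype.card_ne_zero
  have hfac : ∀ i : Fin m, ((Fintype.card F ^ m - Fintype.card F ^ (i : ℕ) : ℕ) : ℝ) =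
      (1 - 1 / (Fintype.card F : ℝ) ^ (m - i)) * (Fintype.card F : ℝ) ^ m := by
    intro i
    rw [Nat.cast_sub (Nat.pow_le_pow_right Fintype.card_pos i.2.le)]
    push_cast
    rw [sub_mul, one_mul, pow_sub₀ _ hq i.2.le]
    field_simp
  rw [Matrix.card_GL_field, Nat.cast_prod, Finset.prod_congr rfl fun i _ => hfac i,
    Finset.prod_mul_distrib, Finset.prod_const, Finset.card_univ, Fintype.card_fin, ← pow_mul,
    Fin.prod_univ_eq_prod_range (fun i => 1 - 1 / (Fintype.card F : ℝ) ^ (m - i)) m,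
    invertibleRatio]
  congr 1
  refine Finset.prod_bij' (fun i _ => m - i) (fun i _ => m - i) ?_ ?_ ?_ ?_ ?_ <;>
    simp <;> omega

/-- The number of translates `A + M` of a fixed square matrix that are invertible. -/
theorem card_det_add_ne_zero {J : Type*} [Fintype J] [DecidableEq J] (A : Matrix J J F) :
    (Nat.card {M : J → J → F // (A + Matrix.of M).det ≠ 0} : ℝ) =
      invertibleRatio (Fintype.card F) (Fintype.card J) * (Nat.card (J → J → F) : ℝ) := by
  have h1 : Nat.card {M : J → J → F // (A + Matrix.of M).det ≠ 0} = Nat.card (GL J F) := by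
    refine Nat.card_congr (Equiv.trans (Equiv.subtypeEquiv (q := fun M : Matrix J J F => IsUnit M)
      (Matrix.of.trans (Equiv.addLeft A)) fun M => ?_) ?_)
    · rw [Matrix.isUnit_iff_isUnit_det, isUnit_iff_ne_zero]
      rfl
    · exact ⟨fun M => M.2.unit, fun u => ⟨u, u.isUnit⟩, fun M => Subtype.ext rfl,
        fun u => Units.ext rfl⟩
  have h2 : Nat.card (GL J F) = Nat.card (GL (Fin (Fintype.card J)) F) :=
    Nat.card_congr (Units.mapEquiv
      (Matrix.reindexAlgEquiv F F (Fintype.equivFin J)).toMulEquiv).toEquiv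
  rw [h1, h2, card_GL_eq_invertibleRatio_mul]
  congr 1
  simp only [Nat.card_eq_fintype_card, Fintype.card_pi, Finset.prod_const, Finset.card_univ]
  push_cast
  rw [pow_mul]

end MatrixCount

open Classical in
/-- If every `k ∈ G` has at least `r` translates `k + s M` in `G'`, among the `|μ|` possible ones,
then `|G'| ≥ (r / |μ|) |G|`. -/
theorem card_mul_le_of_translates {α μ : Type*} [Fintype α] [AddGroup α] [Fintype μ]
    [Nonempty μ] (s : μ → α) (G G' : Finset α) (r : ℝ)
    (h : ∀ k ∈ G, r * (Nat.card μ : ℝ) ≤ (Nat.card {M : μ // k + s M ∈ G'} : ℝ)) :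
    r * (G.card : ℝ) ≤ (G'.card : ℝ) := by
  simp only [Nat.card_eq_fintype_card, Fintype.card_subtype] at h
  have hμ : (0 : ℝ) < Fintype.card μ := by exact_mod_cast Fintype.card_pos
  -- Double count the pairs `(k, M)` with `k + s M ∈ G'`. For fixed `M`, translation is a bijection,
  -- so there are `|G'|` of them.
  have hswap := Finset.sum_card_bipartiteAbove_eq_sum_card_bipartiteBelow
    (s := (Finset.univ : Finset α)) (t := (Finset.univ : Finset μ)) (fun k M => k + s M ∈ G')
  have hright : ∀ M : μ, (Finset.bipartiteBelow (fun k M => k + s M ∈ G')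
      (Finset.univ : Finset α) M).card = G'.card := by
    intro M
    refine Finset.card_bij (fun k _ => k + s M) (fun k hk => ?_) (fun _ _ _ _ h => ?_)
      fun k hk => ⟨k - s M, ?_, ?_⟩
    · simpa [Finset.bipartiteBelow] using hk
    · simpa using h
    · simpa [Finset.bipartiteBelow] using hk
    · simp
  simp only [hright, Finset.sum_const, Finset.card_univ, smul_eq_mul] at hswap
  have hleft : (G.card : ℝ) * (r * Fintype.card μ) ≤ (Fintype.card μ : ℝ) * G'.card := by
    calc (G.card : ℝ) * (r * Fintype.card μ)
        = ∑ _k ∈ G, r * (Fintype.card μ : ℝ) := by rw [Finset.sum_const, nsmul_eq_mul]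
      _ ≤ ∑ k ∈ G, (({M : μ | k + s M ∈ G'} : Finset μ).card : ℝ) := Finset.sum_le_sum h
      _ ≤ ∑ k, (({M : μ | k + s M ∈ G'} : Finset μ).card : ℝ) :=
        Finset.sum_le_univ_sum_of_nonneg fun _ => Nat.cast_nonneg _
      _ = (Fintype.card μ : ℝ) * G'.card := by exact_mod_cast hswap
  nlinarith

/-! ### Node numbering and the dependence of kernels on coefficients -/

namespace Network

variable {V E : Type*} (N : Network V E)

/-- The nodes of a finite acyclic network can be numbered along its channels. -/
theorem exists_topological_numbering [Finite V] :
    ∃ h : V → ℕ, Function.Injective h ∧ ∀ e, h (N.tail e) < h (N.head e) := by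
  classical
  let r : V → V → Prop := Relation.ReflTransGen fun a b => ∃ e, N.tail e = a ∧ N.head e = b
  have hr : IsPartialOrder V r :=
    { refl := fun _ => Relation.ReflTransGen.refl
      trans := fun _ _ _ => Relation.ReflTransGen.trans
      antisymm := fun a b hab hba => by
        rcases Relation.reflTransGen_iff_eq_or_transGen.1 hab with h | h
        · exact h.symm
        · exact (N.acyclic a (h.trans_left hba)).elim }
  -- Extend reachability to a linear order and number each node by its count of strict predecessors.
  obtain ⟨s, hs, hrs⟩ := extend_partialOrder r
  have hlt : ∀ a b, s a b → a ≠ b → {u | s u a ∧ u ≠ a}.ncard < {u | s u b ∧ u ≠ b}.ncard := by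
    intro a b hab hne
    refine Set.ncard_lt_ncard ⟨fun u hu => ⟨hs.trans _ _ _ hu.1 hab, ?_⟩, fun hsub => ?_⟩
      (Set.toFinite _)
    · rintro rfl
      exact hne (hs.antisymm _ _ hab hu.1)
    · exact (hsub (show a ∈ {u | s u b ∧ u ≠ b} from ⟨hab, hne⟩)).2 rfl
  refine ⟨fun v => {u | s u v ∧ u ≠ v}.ncard, fun a b hab => ?_, fun e => ?_⟩
  · by_contra hne
    rcases hs.total a b with h | h
    · exact (hlt a b h hne).ne hab
    · exact (hlt b a h (Ne.symm hne)).ne hab.symm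
  · refine hlt _ _ (hrs _ _ (Relation.ReflTransGen.single ⟨e, rfl, rfl⟩)) fun h => ?_
    exact N.acyclic (N.tail e) (.single ⟨e, rfl, h.symm⟩)

variable {F : Type*} [Field F] [Fintype E] {w : ℕ}

/-- The global encoding kernels, those of the imaginary channels included. -/
noncomputable def extKernel (k : N.AdjPair w → F) : Fin w ⊕ E → (Fin w → F) :=
  Sum.elim (fun j => Pi.single j 1) (N.kernel k)

/-- Kernels only depend on the coefficients at nodes upstream. -/
theorem kernel_congr {h : V → ℕ} (hh : ∀ e, h (N.tail e) < h (N.head e)) {n : ℕ}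
    {k k' : N.AdjPair w → F} (hk : ∀ x : N.AdjPair w, h (N.tail x.1) < n → k x = k' x) (e : E)
    (he : h (N.tail e) < n) : N.kernel k e = N.kernel k' e := by
  induction e using N.precedes_wf.induction with
  | _ e ih =>
    rw [kernel_eq, kernel_eq]
    refine Finset.sum_congr rfl fun d _ => ?_
    rw [hk ⟨e, d⟩ he]
    rcases d with ⟨j | d, hd⟩
    · rfl
    · have hd' : N.head d = N.tail e := hd
      simp only [Sum.elim_inr]
      rw [ih d hd' ((hh d).trans (hd' ▸ he))]

/-- The kernels of the selected channels, as rows of a square matrix. -/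
noncomputable def kernelMatrix (c : Fin w → Fin w ⊕ E) (k : N.AdjPair w → F) :
    Matrix (Fin w) (Fin w) F := Matrix.of fun j => N.extKernel k (c j)

open Classical in
/-- The coefficients for which the kernels of the selected channels are a basis. -/
noncomputable def regularCoeffs [Fintype F] (c : Fin w → Fin w ⊕ E) :
    Finset (N.AdjPair w → F) :=
  {k | (N.kernelMatrix c k).det ≠ 0}

theorem mem_regularCoeffs [Fintype F] (c : Fin w → Fin w ⊕ E) (k : N.AdjPair w → F) :
    k ∈ N.regularCoeffs c ↔ (N.kernelMatrix c k).det ≠ 0 := by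
  simp [regularCoeffs]

end Network

namespace Network

variable {V E : Type*} (N : Network V E)
variable {F : Type*} [Field F] [Fintype E] {w : ℕ}

theorem extKernel_congr {h : V → ℕ} (hh : ∀ e, h (N.tail e) < h (N.head e)) {n : ℕ}
    {k k' : N.AdjPair w → F} (hk : ∀ x : N.AdjPair w, h (N.tail x.1) < n → k x = k' x)
    (d : Fin w ⊕ E) (hd : ∀ e, d = .inr e → h (N.tail e) < n) :
    N.extKernel k d = N.extKernel k' d := by
  rcases d with j | e
  · rfl
  · exact N.kernel_congr hh hk e (hd e rfl)

/-- The adjacent pair of two given channels. -/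
def adjPair {d : Fin w ⊕ E} {e : E} (h : N.extHead w d = N.tail e) : N.AdjPair w := ⟨e, ⟨d, h⟩⟩

/-- The coefficients `M j i` on the adjacent pairs `(d i, e j)`, and zero elsewhere. -/
noncomputable def blockCoeffs {J : Type*} {d : J → Fin w ⊕ E} {e : J → E}
    (hd : ∀ j i, N.extHead w (d i) = N.tail (e j)) (M : J → J → F) : N.AdjPair w → F :=
  Function.extend (fun x : J × J => N.adjPair (hd x.1 x.2)) (fun x => M x.1 x.2) 0

/-- Changing the coefficients between the channels `d i` and the channels `e j` leaving `v` by
`M j i` adds `∑ i, M j i • f_{d i}` to the kernel of `e j`, and does not affect what lies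
upstream. -/
theorem kernel_add_blockCoeffs {h : V → ℕ}
    (hh : ∀ e, h (N.tail e) < h (N.head e)) {v : V} {J : Type*} [Fintype J] {e : J → E}
    (he : ∀ j, N.tail (e j) = v) (heinj : Function.Injective e) {d : J → Fin w ⊕ E}
    (hd : ∀ j i, N.extHead w (d i) = N.tail (e j)) (hdinj : Function.Injective d)
    (k : N.AdjPair w → F) (M : J → J → F) :
    (∀ x : N.AdjPair w, h (N.tail x.1) < h v → (k + N.blockCoeffs hd M) x = k x) ∧
      ∀ j, N.kernel (k + N.blockCoeffs hd M) (e j) =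
        N.kernel k (e j) + ∑ i, M j i • N.extKernel k (d i) := by
  have hpair : Function.Injective (fun x : J × J => N.adjPair (hd x.1 x.2)) := by
    rintro ⟨j, i⟩ ⟨j', i'⟩ hx
    have h1 : e j = e j' := congrArg (fun y : N.AdjPair w => y.1) hx
    have h2 : d i = d i' := congrArg (fun y : N.AdjPair w => y.2.1) hx
    rw [heinj h1, hdinj h2]
  have hup : ∀ x : N.AdjPair w, h (N.tail x.1) < h v → (k + N.blockCoeffs hd M) x = k x := by
    intro x hx
    have : ¬ ∃ y : J × J, N.adjPair (hd y.1 y.2) = x := by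
      rintro ⟨y, rfl⟩
      exact hx.ne (congrArg h (he y.1))
    rw [Pi.add_apply, blockCoeffs, Function.extend_apply' _ _ _ this, Pi.zero_apply, add_zero]
  refine ⟨hup, fun j => ?_⟩
  -- The inputs of `e j` arrive at `v`, so their tails are numbered below `v` and their kernels do
  -- not see the change.
  have hext : ∀ x : N.Inputs w (e j),
      N.extKernel (k + N.blockCoeffs hd M) x.1 = N.extKernel k x.1 := by
    intro x
    refine N.extKernel_congr hh hup x.1 fun e' he' => ?_
    have hx : N.extHead w x.1 = N.tail (e j) := x.2
    rw [he'] at hx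
    rw [← he j, ← hx]
    exact hh e'
  rw [kernel_eq, kernel_eq]
  change ∑ x : N.Inputs w (e j), (k + N.blockCoeffs hd M) ⟨e j, x⟩ •
      N.extKernel (k + N.blockCoeffs hd M) x.1 =
    ∑ x : N.Inputs w (e j), k ⟨e j, x⟩ • N.extKernel k x.1 + _
  have hsum : ∑ i, M j i • N.extKernel k (d i) = ∑ x : N.Inputs w (e j),
      N.blockCoeffs hd M ⟨e j, x⟩ • N.extKernel k x.1 := by
    let g : J → N.Inputs w (e j) := fun i => ⟨d i, hd j i⟩
    refine Fintype.sum_of_injective g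
      (fun i i' hi => hdinj (congrArg Subtype.val hi)) _ _ (fun x hx => ?_) fun i => ?_
    · have h0 : N.blockCoeffs hd M ⟨e j, x⟩ = 0 := by
        refine Function.extend_apply' _ _ _ ?_
        rintro ⟨⟨j', i⟩, hy⟩
        exact hx ⟨i, Subtype.ext (congrArg (fun y : N.AdjPair w => y.2.1) hy)⟩
      rw [h0, zero_smul]
    · have h1 : N.blockCoeffs hd M ⟨e j, g i⟩ = M j i :=
        hpair.extend_apply (fun x => M x.1 x.2) 0 (j, i)
      rw [h1]
  rw [hsum, ← Finset.sum_add_distrib]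
  refine Finset.sum_congr rfl fun x _ => ?_
  rw [hext, ← add_smul]
  rfl

end Network

/-- Replace the rows in `p` of the invertible matrix `B` by those of `C`, and add to them the
combinations of the rows of `B` in `p` with coefficients `M`. The result is invertible if `A + M`
is, for a matrix `A` that does not depend on `M`. -/
theorem Matrix.exists_translate_det_ne_zero {n F : Type*} [Fintype n] [DecidableEq n] [Field F]
    (B C : Matrix n n F) (hB : B.det ≠ 0) (p : n → Prop)
    [DecidablePred p] :
    ∃ A : Matrix {j // p j} {j // p j} F, ∀ (M : {j // p j} → {j // p j} → F) (C' : Matrix n n F),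
      (∀ j, ¬ p j → C' j = B j) → (∀ j : {j // p j}, C' j = C j + ∑ i, M j i • B i.1) →
      (A + Matrix.of M).det ≠ 0 → C'.det ≠ 0 := by
  have hu : IsUnit B.det := isUnit_iff_ne_zero.2 hB
  have hrow1 : ∀ (D : Matrix n n F) j, D j = B j → (D * B⁻¹) j = (1 : Matrix n n F) j := by
    intro D j hj
    rw [← Matrix.mul_nonsing_inv B hu]
    ext i
    simp [Matrix.mul_apply, hj]
  -- In the basis of the rows of `B`, the rows of `C'` outside `p` become unit rows. Hence `C' *
  -- B⁻¹` is block triangular and its determinant is that of the `p`-block, which is `A + M`.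
  refine ⟨(C * B⁻¹).toSquareBlockProp p, fun M C' h1 h2 hdet => ?_⟩
  have hD : (C' * B⁻¹).det = ((C * B⁻¹).toSquareBlockProp p + Matrix.of M).det := by
    rw [Matrix.twoBlockTriangular_det (C' * B⁻¹) p]
    · have hone : (C' * B⁻¹).toSquareBlockProp (fun i => ¬ p i) = 1 := by
        ext i j
        rw [Matrix.toSquareBlockProp_def, Matrix.of_apply, hrow1 C' i.1 (h1 i.1 i.2)]
        simp [Matrix.one_apply, Subtype.ext_iff]
      rw [hone, Matrix.det_one, mul_one]
      congr 1
      ext j i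
      have hexp : (C' * B⁻¹) j.1 i.1 =
          (C * B⁻¹) j.1 i.1 + ∑ l : {j // p j}, M j l * (B * B⁻¹) l.1 i.1 := by
        simp only [Matrix.mul_apply, h2 j, Pi.add_apply, Finset.sum_apply, Pi.smul_apply,
          smul_eq_mul, add_mul, Finset.sum_add_distrib, Finset.sum_mul, Finset.mul_sum]
        rw [Finset.sum_comm]
        simp only [mul_assoc]
      rw [Matrix.mul_nonsing_inv B hu] at hexp
      simpa [Matrix.toSquareBlockProp_def, Matrix.one_apply, ← Subtype.ext_iff] using hexp
    · intro i hi j hj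
      rw [hrow1 C' i (h1 i hi), Matrix.one_apply_ne]
      rintro rfl
      exact hi hj
  intro h0
  rw [← hD, Matrix.det_mul, h0, zero_mul] at hdet
  exact hdet rfl

/-! ### Sweeping a cut along the paths -/

namespace Network

variable {V E : Type*} (N : Network V E)
variable {F : Type*} [Field F] [Fintype F] [Fintype E] {w : ℕ}

/-- Advancing a cut past the node `v` keeps the kernels on the cut a basis with probability at
least `invertibleRatio q w`. -/
theorem invertibleRatio_mul_card_regularCoeffs_le {h : V → ℕ}
    (hh : ∀ e, h (N.tail e) < h (N.head e)) (v : V) {c c' : Fin w → Fin w ⊕ E}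
    (hc : Function.Injective c) (hc' : Function.Injective c')
    (hup : ∀ j e, c j = .inr e → h (N.tail e) < h v)
    (hstep : ∀ j, c' j = c j ∨ ∃ e, c' j = .inr e ∧ N.tail e = v ∧ N.extHead w (c j) = v) :
    invertibleRatio (Fintype.card F) w * ((N.regularCoeffs (F := F) c).card : ℝ) ≤
      ((N.regularCoeffs (F := F) c').card : ℝ) := by
  classical
  -- The indices of the paths whose cut channel is advanced through `v`.
  let p : Fin w → Prop := fun j => ∃ e, c' j = .inr e ∧ N.tail e = v ∧ N.extHead w (c j) = v
  choose e he1 he2 he3 using fun j : {j // p j} => j.2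
  have heinj : Function.Injective e := fun i j hij => by
    have := (he1 i).trans ((congrArg Sum.inr hij).trans (he1 j).symm)
    exact Subtype.ext (hc' this)
  have hdinj : Function.Injective (fun j : {j // p j} => c j.1) := fun i j hij =>
    Subtype.ext (hc hij)
  have hd : ∀ j i : {j // p j}, N.extHead w (c i.1) = N.tail (e j) := fun j i =>
    (he3 i).trans (he2 j).symm
  refine card_mul_le_of_translates (N.blockCoeffs (F := F) hd) _ _ _ fun k hk => ?_
  rw [mem_regularCoeffs] at hk
  obtain ⟨A, hA⟩ := Matrix.exists_translate_det_ne_zero (N.kernelMatrix c k)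
    (N.kernelMatrix c' k) hk p
  have hle : ∀ M : {j // p j} → {j // p j} → F, (A + Matrix.of M).det ≠ 0 →
      k + N.blockCoeffs hd M ∈ N.regularCoeffs c' := by
    intro M hM
    rw [mem_regularCoeffs]
    obtain ⟨h1, h2⟩ := N.kernel_add_blockCoeffs hh he2 heinj hd hdinj k M
    refine hA M _ (fun j hj => ?_) (fun j => ?_) hM
    · have hcj : c' j = c j := (hstep j).resolve_right hj
      change N.extKernel _ (c' j) = N.extKernel k (c j)
      rw [hcj]
      exact N.extKernel_congr hh h1 _ (hup j)
    · change N.extKernel _ (c' j) = N.extKernel k (c' j) + ∑ i, M j i • N.extKernel k (c i)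
      rw [he1]
      exact h2 j
  calc _ ≤ invertibleRatio (Fintype.card F) (Fintype.card {j // p j}) *
        (Nat.card ({j // p j} → {j // p j} → F) : ℝ) :=
        mul_le_mul_of_nonneg_right (invertibleRatio_anti Fintype.card_pos
          (by simpa using Fintype.card_subtype_le p)) (Nat.cast_nonneg _)
    _ = (Nat.card {M : {j // p j} → {j // p j} → F // (A + Matrix.of M).det ≠ 0} : ℝ) :=
        (card_det_add_ne_zero A).symm
    _ ≤ _ := Nat.cast_le.2 (Nat.card_le_card_of_injective (Subtype.map id hle)
        (Subtype.map_injective _ Function.injective_id))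

/-- The channel `d` belongs to the path `p` from the `j`-th imaginary channel onwards and crosses
the cut between the nodes with numbers less than `n` and the others. -/
def Crosses (h : V → ℕ) (n : ℕ) (j : Fin w) (p : List E) (d : Fin w ⊕ E) : Prop :=
  (d = .inl j ∧ n ≤ h N.source) ∨
    ∃ e ∈ p, d = .inr e ∧ h (N.tail e) < n ∧ n ≤ h (N.head e)

omit [Fintype E] in
-- Disjointness separates the real channels, and the imaginary ones carry their own index `j`.
theorem Crosses.injective {h : V → ℕ} {n : ℕ} {P : Fin w → List E}
    (hdisj : ∀ i j, i ≠ j → List.Disjoint (P i) (P j)) {c : Fin w → Fin w ⊕ E}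
    (hc : ∀ j, N.Crosses h n j (P j) (c j)) : Function.Injective c := by
  intro i j hij
  by_contra hne
  rcases hc i with ⟨h1, -⟩ | ⟨e, he, h1, -⟩ <;> rcases hc j with ⟨h2, -⟩ | ⟨e', he', h2, -⟩ <;>
    rw [hij, h2] at h1
  · exact hne (Sum.inl.inj h1).symm
  · simp at h1
  · simp at h1
  · exact hdisj i j hne he (Sum.inr.inj h1 ▸ he')

omit [Fintype E] in
/-- A channel crossing the cut at `n + 1` either crosses the cut at `n` or leaves the node with
number `n`, at which then arrives a channel of the same path that crosses the cut at `n`. -/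
theorem Crosses.exists_pred {h : V → ℕ} (hh : ∀ e, h (N.tail e) < h (N.head e)) {n : ℕ} {j : Fin w} {p : List E} {d' : Fin w ⊕ E}
    (hp : ∀ e ∈ p, N.tail e = N.source ∨ ∃ d ∈ p, N.Precedes d e)
    (hd' : N.Crosses h (n + 1) j p d') :
    ∃ d, N.Crosses h n j p d ∧ (d' = d ∨ ∃ e ∈ p, d' = .inr e ∧ h (N.tail e) = n ∧
      N.extHead w d = N.tail e) := by
  rcases hd' with ⟨rfl, hn⟩ | ⟨e, he, rfl, h1, h2⟩
  · exact ⟨_, Or.inl ⟨rfl, by omega⟩, Or.inl rfl⟩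
  · rcases Nat.lt_succ_iff_lt_or_eq.1 h1 with h1 | h1
    · exact ⟨_, Or.inr ⟨e, he, rfl, h1, by omega⟩, Or.inl rfl⟩
    -- At the source, the first channel of the path is preceded by the imaginary channel `j`.
    · rcases hp e he with hs | ⟨d, hd, hde⟩
      · exact ⟨.inl j, Or.inl ⟨rfl, by rw [← hs, h1]⟩, Or.inr ⟨e, he, rfl, h1, hs.symm⟩⟩
      · have hde' : N.head d = N.tail e := hde
        have := hh d
        exact ⟨.inr d, Or.inr ⟨d, hd, rfl, by rw [← h1, ← hde']; exact this,
          by rw [hde', h1]⟩, Or.inr ⟨e, he, rfl, h1, hde⟩⟩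

theorem regularCoeffs_inl (c : Fin w → Fin w ⊕ E) (hc : ∀ j, c j = .inl j) :
    ∀ k : N.AdjPair w → F, k ∈ N.regularCoeffs c := by
  intro k
  have : N.kernelMatrix c k = 1 := by
    ext i j
    simp [kernelMatrix, hc, extKernel, Matrix.one_apply, Pi.single_apply, eq_comm]
  rw [mem_regularCoeffs, this, Matrix.det_one]
  exact one_ne_zero

open Classical in
/-- For a cut across `w` channel-disjoint paths, the kernels of the channels on it are a basis with
probability at least `invertibleRatio q w ^ m`, where `m` is the number of nodes before the cut
from which the paths leave. -/
theorem invertibleRatio_pow_mul_card_le [Finite V] {h : V → ℕ} (hinj : Function.Injective h)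
    (hh : ∀ e, h (N.tail e) < h (N.head e)) {P : Fin w → List E}
    (hP : ∀ j, ∀ e ∈ P j, N.tail e = N.source ∨ ∃ d ∈ P j, N.Precedes d e)
    (hdisj : ∀ i j, i ≠ j → List.Disjoint (P i) (P j)) (n : ℕ) {c : Fin w → Fin w ⊕ E}
    (hc : ∀ j, N.Crosses h n j (P j) (c j)) :
    invertibleRatio (Fintype.card F) w ^
        {v | h v < n ∧ ∃ j, ∃ e ∈ P j, N.tail e = v}.ncard *
      (Fintype.card (N.AdjPair w → F) : ℝ) ≤ ((N.regularCoeffs (F := F) c).card : ℝ) := by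
  have hq : 1 ≤ Fintype.card F := Fintype.card_pos
  induction n generalizing c with
  | zero =>
    have hc0 : ∀ j, c j = .inl j := fun j => by
      rcases hc j with ⟨h1, -⟩ | ⟨e, -, -, h1, -⟩
      · exact h1
      · exact absurd h1 (Nat.not_lt_zero _)
    rw [Finset.eq_univ_of_forall (N.regularCoeffs_inl (F := F) c hc0), Finset.card_univ]
    have : {v | h v < 0 ∧ ∃ j, ∃ e ∈ P j, N.tail e = v} = ∅ := by
      ext v
      simp
    rw [this, Set.ncard_empty, pow_zero, one_mul]
  | succ n ih =>
    choose b hb hbc using fun j => Crosses.exists_pred N hh (hP j) (hc j)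
    have hsub : {v | h v < n ∧ ∃ j, ∃ e ∈ P j, N.tail e = v} ⊆
        {v | h v < n + 1 ∧ ∃ j, ∃ e ∈ P j, N.tail e = v} := fun v hv => ⟨by
      have := hv.1
      omega, hv.2⟩
    -- Only a node numbered `n` that some path leaves costs a factor. If there is none, the cut
    -- channels do not change.
    by_cases hv : ∃ v, h v = n ∧ ∃ j, ∃ e ∈ P j, N.tail e = v
    · obtain ⟨v, hvn, hvP⟩ := hv
      have hlt : {v | h v < n ∧ ∃ j, ∃ e ∈ P j, N.tail e = v}.ncard <
          {v | h v < n + 1 ∧ ∃ j, ∃ e ∈ P j, N.tail e = v}.ncard := by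
        refine Set.ncard_lt_ncard ⟨hsub, fun hsub' => ?_⟩ (Set.toFinite _)
        have : h v < n := (hsub' (show v ∈ {v | h v < n + 1 ∧ _} from ⟨by omega, hvP⟩)).1
        omega
      have hadv := N.invertibleRatio_mul_card_regularCoeffs_le (F := F) hh v
        (Crosses.injective N hdisj hb) (Crosses.injective N hdisj hc) (fun j e he => by
          rcases hb j with ⟨h1, -⟩ | ⟨e', -, h1, h2, -⟩ <;> rw [he] at h1
          · simp at h1
          · rw [Sum.inr.inj h1, hvn]
            exact h2) fun j => (hbc j).imp_right fun ⟨e, _, h1, h2, h3⟩ =>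
          have hev : N.tail e = v := hinj (h2.trans hvn.symm)
          ⟨e, h1, hev, h3.trans hev⟩
      refine le_trans ?_ hadv
      refine le_trans ?_ (mul_le_mul_of_nonneg_left (ih hb) (invertibleRatio_nonneg hq w))
      rw [← mul_assoc, ← pow_succ']
      exact mul_le_mul_of_nonneg_right (pow_le_pow_of_le_one (invertibleRatio_nonneg hq w)
        (invertibleRatio_le_one hq w) hlt) (Nat.cast_nonneg _)
    · have hbc' : c = b := funext fun j => (hbc j).resolve_right fun ⟨e, he, _, h2, _⟩ =>
        hv ⟨_, h2, j, e, he, rfl⟩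
      subst hbc'
      exact (mul_le_mul_of_nonneg_right (pow_le_pow_of_le_one (invertibleRatio_nonneg hq w)
        (invertibleRatio_le_one hq w) (Set.ncard_le_ncard hsub (Set.toFinite _)))
        (Nat.cast_nonneg _)).trans (ih hb)

open Classical in
/-- If the kernels of channels arriving at `t` are a basis, then the decoding matrix has full
rank. -/
theorem le_rank_decodingMatrix {t : V} {e : Fin w → E} (he : ∀ j, N.head (e j) = t)
    {k : N.AdjPair w → F} (hk : k ∈ N.regularCoeffs fun j => .inr (e j)) :
    w ≤ (N.decodingMatrix k t).rank := by
  rw [mem_regularCoeffs] at hk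
  have hli : LinearIndependent F fun j => N.kernel k (e j) :=
    Matrix.linearIndependent_rows_of_det_ne_zero hk
  rw [Matrix.rank_eq_finrank_span_cols]
  have hspan : Submodule.span F (Set.range fun j => N.kernel k (e j)) ≤
      Submodule.span F (Set.range (N.decodingMatrix k t).col) := by
    refine Submodule.span_mono ?_
    rintro _ ⟨j, rfl⟩
    exact ⟨⟨e j, he j⟩, rfl⟩
  calc w = Module.finrank F (Submodule.span F (Set.range fun j => N.kernel k (e j))) := by
        rw [finrank_span_eq_card hli, Fintype.card_fin]
    _ ≤ _ := Submodule.finrank_mono hspan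

end Network

/-! ### From counting to probability -/

open Classical in
/-- Finitely many independent uniform random variables are jointly uniform. -/
theorem measureReal_preimage_of_uniform {Ω ι F : Type*} [MeasurableSpace Ω] [Fintype ι] [Fintype F]
    [MeasurableSpace F] [MeasurableSingletonClass F]
    (μ : MeasureTheory.Measure Ω) [MeasureTheory.IsProbabilityMeasure μ] (K : ι → Ω → F)
    (hmeas : ∀ p, Measurable (K p)) (hindep : ProbabilityTheory.iIndepFun K μ)
    (hunif : ∀ p a, μ.real (K p ⁻¹' {a}) = 1 / (Fintype.card F : ℝ)) (S : Finset (ι → F)) :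
    μ.real {ω | (fun p => K p ω) ∈ S} = (S.card : ℝ) / (Fintype.card (ι → F) : ℝ) := by
  have hatom : ∀ k : ι → F, {ω | (fun p => K p ω) = k} = ⋂ p ∈ Finset.univ, K p ⁻¹' {k p} := by
    intro k
    ext ω
    simp [funext_iff]
  have hms : ∀ k : ι → F, MeasurableSet {ω | (fun p => K p ω) = k} := fun k => by
    rw [hatom]
    exact Finset.measurableSet_biInter _ fun p _ => hmeas p (measurableSet_singleton _)
  have hprob : ∀ k : ι → F,
      μ.real {ω | (fun p => K p ω) = k} = 1 / (Fintype.card (ι → F) : ℝ) := by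
    intro k
    rw [MeasureTheory.measureReal_def, hatom,
      hindep.measure_inter_preimage_eq_mul _ fun _ _ => measurableSet_singleton _,
      ENNReal.toReal_prod]
    have : ∀ p, (μ (K p ⁻¹' {k p})).toReal = 1 / (Fintype.card F : ℝ) := fun p => hunif p (k p)
    simp [this, Fintype.card_pi]
  have hunion : {ω | (fun p => K p ω) ∈ S} = ⋃ k ∈ S, {ω | (fun p => K p ω) = k} := by
    ext ω
    simp
  rw [hunion, MeasureTheory.measureReal_biUnion_finset (fun k _ k' _ hkk' => ?_) fun k _ => hms k,
    Finset.sum_congr rfl fun k _ => hprob k, Finset.sum_const, nsmul_eq_mul, mul_one_div]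
  exact Set.disjoint_left.2 fun ω h1 h2 => hkk' (h1.symm.trans h2)

theorem theorem8 {V E : Type*} [Finite V] [Fintype E] (N : Network V E)
    {F : Type*} [Field F] [Fintype F] [MeasurableSpace F] [MeasurableSingletonClass F]
    (w : ℕ) (t : V) (ht : t ≠ N.source) (hw : w ≤ N.minCut t)
    {Ω : Type*} [MeasurableSpace Ω] (μ : MeasureTheory.Measure Ω)
    [MeasureTheory.IsProbabilityMeasure μ]
    (K : N.AdjPair w → Ω → F) (hmeas : ∀ p, Measurable (K p))
    (hindep : ProbabilityTheory.iIndepFun K μ)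
    (hunif : ∀ p a, μ.real (K p ⁻¹' {a}) = 1 / (Fintype.card F : ℝ)) :
    (∃ P : Fin w → List E, N.IsDisjointPaths t P) ∧
      ∀ P : Fin w → List E, N.IsDisjointPaths t P →
        N.sinkFailureProb μ K t ≤
          1 - (∏ i ∈ Finset.Icc 1 w, (1 - 1 / (Fintype.card F : ℝ) ^ i)) ^
            ((N.internalNodes t P).ncard + 1) := by

  refine ⟨N.exists_disjointPaths w t ht hw, fun P hP => ?_⟩
  classical
  obtain ⟨h, hinj, hh⟩ := N.exists_topological_numbering
  have hpred : ∀ j, ∀ e ∈ P j, N.tail e = N.source ∨ ∃ d ∈ P j, N.Precedes d e := by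
    intro j e he
    refine ((hP.1 j).1.eq_head_or_exists_rel he).imp_left fun h0 => ?_
    have := (hP.1 j).2.1
    rw [h0] at this
    exact Option.some.inj this
  have hlast : ∀ j, ∃ e ∈ P j, N.head e = t := fun j => by
    obtain ⟨e, he, het⟩ := Option.map_eq_some_iff.1 (hP.1 j).2.2
    exact ⟨e, List.mem_of_getLast? he, het⟩
  choose e heP het using hlast
  -- At the cut `n = h t`, the channels by which the paths arrive at `t` are crossing channels.
  have hcount := N.invertibleRatio_pow_mul_card_le (F := F) hinj hh hpred hP.2 (h t)
    (c := fun j => .inr (e j)) fun j => Or.inr ⟨e j, heP j, rfl, het j ▸ hh (e j), by rw [het]⟩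
  set φ := invertibleRatio (Fintype.card F) w with hφ
  have hq : 1 ≤ Fintype.card F := Fintype.card_pos
  -- The strict inequality `h v < h t` excludes `t` itself; the `+ 1` accounts for the source.
  have hnodes : {v | h v < h t ∧ ∃ j, ∃ e ∈ P j, N.tail e = v}.ncard ≤
      (N.internalNodes t P).ncard + 1 := by
    refine (Set.ncard_le_ncard (t := insert N.source (N.internalNodes t P)) ?_
      (Set.toFinite _)).trans (Set.ncard_insert_le _ _)
    rintro v ⟨hvt, j, d, hd, hdv⟩
    rw [Set.mem_insert_iff, or_iff_not_imp_left]
    exact fun hvs => ⟨hvs, fun h0 => by simp [h0] at hvt, j, d, hd, Or.inl hdv⟩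
  have hpow := pow_le_pow_of_le_one (invertibleRatio_nonneg hq w) (invertibleRatio_le_one hq w)
    hnodes
  rw [← hφ] at hpow
  set S := N.regularCoeffs (F := F) fun j => .inr (e j) with hS
  have hcard : (0 : ℝ) < Fintype.card (N.AdjPair w → F) := by exact_mod_cast Fintype.card_pos
  have hsub : {ω | (N.decodingMatrix (fun p => K p ω) t).rank < w} ⊆
      {ω | (fun p => K p ω) ∈ Sᶜ} := by
    intro ω hω
    rw [Set.mem_ofPred_eq, Finset.mem_compl]
    exact fun hk => (N.le_rank_decodingMatrix het hk).not_gt hω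
  calc N.sinkFailureProb μ K t ≤ μ.real {ω | (fun p => K p ω) ∈ Sᶜ} :=
        MeasureTheory.measureReal_mono hsub
    _ = ((Sᶜ).card : ℝ) / (Fintype.card (N.AdjPair w → F) : ℝ) := by
        rw [measureReal_preimage_of_uniform μ K hmeas hindep hunif]
    _ = 1 - (S.card : ℝ) / (Fintype.card (N.AdjPair w → F) : ℝ) := by
        rw [Finset.card_compl, Nat.cast_sub (Finset.card_le_univ _), sub_div, div_self hcard.ne']
    _ ≤ 1 - φ ^ ((N.internalNodes t P).ncard + 1) := by
        refine sub_le_sub_left (hpow.trans ?_) 1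
        rw [le_div_iff₀ hcard]
        convert hcount
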